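/- **Conventions.** Fix an integer $k\ge 0$. All maps are continuous; a map on a set $X\subseteq\mathbb R^k$ is $C^\infty$ if it has a $C^\infty$ extension to an open neighborhood of $X$. A map $f:X\to Y$ between metric spaces is *proper* if $f^{-1}(K)$ is compact for every compact $K\subseteq Y$. Let $U\subseteq\mathbb R^k$ be open, $f$ an $\mathbb R^k$-valued map defined at least on $\overline U$, and $y\in\mathbb R^k$. The triple $(f,U,y)$ is *admissible* if $f$ is proper on $\overline U$ and $f(x)\ne y$ for all $x\in\partial U$. An admissible triple is *regular* if, moreover, $f$ is $C^\infty$ on $\overline U$ and $f'(x)$ is onto for every $x\in f^{-1}(y)\cap U$; for such $x$ put $\mathrm i(f,x)=\operatorname{sign}\det f'(x)$. An *admissible homotopy* is a triple $(H,U,\alpha)$ with $U\subseteq\mathbb R^k$ open, $\alpha:[0,1]\to\mathbb R^k$ a path, and $H$ an $\mathbb R^k$-valued map that is defined at least and proper on $\overline U\times[0,1]$, such that $H(x,\lambda)\neq\alpha(\lambda)$ for all $(x,\lambda)\in\partial U\times[0,1]$. It joins $(H(\cdot,0),U,\alpha(0))$ with $(H(\cdot,1),U,\alpha(1))$. Let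 $\deg$ denote any map that assigns to each admissible triple $(f,U,y)$ in $\mathbb R^k$ an integer $\deg(f,U,y)$ and satisfies the following three axioms. - *(Normalization)* $\deg(I,\mathbb R^k,0)=1$, where $I$ is the identity of $\mathbb R^k$. - *(Additivity)* If $(f,U,y)$ is admissible and $U_1,U_2$ are disjoint open subsets of $U$ with $f^{-1}(y)\cap U\subseteq U_1\cup U_2$, then $\deg(f,U,y)=\deg(f,U_1,y)+\deg(f,U_2,y)$. - *(Homotopy Invariance)* If $(H,U,\alpha)$ is an admissible homotopy, then $\deg(H(\cdot,0),U,\alpha(0))=\deg(H(\cdot,1),U,\alpha(1))$. **Theorem.** Let $(f,U,y)$ be an admissible triple. If $(g,U,z)$ is a regular triple which can be joined to $(f,U,y)$ via an admissible homotopy, then $g^{-1}(z)\cap U$ is finite and $$\deg(f,U,y)=\sum_{x\in g^{-1}(z)\cap U}\mathrm i(g,x).\qquad(*)$$ In particular, $(*)$ holds for any regular triple $(g,U,z)$ for which there are $\varepsilon,\sigma\ge 0$ with $|g(x)-f(x)|\le\varepsilon$ for all $x\in\overline U$, $|z-y|\le\sigma$, and $\varepsilon+\sigma<\operatorname{dist}(y,f(\partial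 U))$ (where $\operatorname{dist}(y,\emptyset)=+\infty$). Consequently, there is at most one integer-valued map on the admissible triples in $\mathbb R^k$ that satisfies Normalization, Additivity and Homotopy Invariance. -/

import Mathlib

open scoped ContDiff

namespace BrouwerDegree

/-- Euclidean `k`-space. -/
abbrev E (k : ℕ) : Type := EuclideanSpace ℝ (Fin k)

variable {k : ℕ}

/-- `(f, U, y)` is an admissible triple: `U` is open, `f` is (continuous and) proper on the closure
of `U`, and `f x ≠ y` on the boundary of `U`. Only the restriction of `f` to `closure U` matters; a
map defined at least on `closure U` is given by a total function, arbitrary off `closure U`. -/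
def Admissible (f : E k → E k) (U : Set (E k)) (y : E k) : Prop :=
  IsOpen U ∧ IsProperMap ((closure U).domRestrict f) ∧ ∀ x ∈ frontier U, f x ≠ y

/-- `f` is `C^∞` on an arbitrary set `X`: it has a `C^∞` extension to an open neighborhood
of `X`. -/
def SmoothOnSet (f : E k → E k) (X : Set (E k)) : Prop :=
  ∃ V : Set (E k), IsOpen V ∧ X ⊆ V ∧
    ∃ F : E k → E k, ContDiffOn ℝ ∞ F V ∧ Set.EqOn F f X

/-- `y` is a regular value of `f` in the open set `U`: the derivative is onto at every `x ∈ U`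
with `f x = y`. -/
def IsRegularValueIn (f : E k → E k) (U : Set (E k)) (y : E k) : Prop :=
  ∀ x ∈ U, f x = y → Function.Surjective (fderiv ℝ f x)

/-- `(f, U, y)` is a regular triple. -/
def Regular (f : E k → E k) (U : Set (E k)) (y : E k) : Prop :=
  Admissible f U y ∧ SmoothOnSet f (closure U) ∧ IsRegularValueIn f U y

/-- The index of `f` at `x`: the sign of the Jacobian determinant. -/
noncomputable def index (f : E k → E k) (x : E k) : ℤ :=
  ((SignType.sign (fderiv ℝ f x).det : SignType) : ℤ)

/-- The set of solutions in `U` of the equation `f x = y`. -/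
def solutions (f : E k → E k) (U : Set (E k)) (y : E k) : Set (E k) := f ⁻¹' {y} ∩ U

/-- `(H, U, α)` is an admissible homotopy of triples: `H` is (continuous and) proper on
`closure U × [0,1]`, `α` is a path on `[0,1]`, and `H (x, t) ≠ α t` for `x` in the boundary of `U`
and `t ∈ [0,1]`. It joins `(H(·, 0), U, α 0)` with `(H(·, 1), U, α 1)`. -/
def AdmissibleHomotopy (H : E k × ℝ → E k) (U : Set (E k)) (α : ℝ → E k) : Prop :=
  IsOpen U ∧ ContinuousOn α (Set.Icc 0 1) ∧
    IsProperMap ((closure U ×ˢ Set.Icc (0 : ℝ) 1).domRestrict H) ∧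
    ∀ x ∈ frontier U, ∀ t ∈ Set.Icc (0 : ℝ) 1, H (x, t) ≠ α t

/-- `(g, U, z)` can be joined to `(f, U, y)` via an admissible homotopy. -/
def JoinedByAdmissibleHomotopy (U : Set (E k)) (g : E k → E k) (z : E k)
    (f : E k → E k) (y : E k) : Prop :=
  ∃ (H : E k × ℝ → E k) (α : ℝ → E k), AdmissibleHomotopy H U α ∧
    Set.EqOn (fun x => H (x, 0)) g (closure U) ∧ α 0 = z ∧
    Set.EqOn (fun x => H (x, 1)) f (closure U) ∧ α 1 = y

/-- The three fundamental properties (Amann–Weiss axioms) of an integer-valued function of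
admissible triples in Euclidean `k`-space. The values of `deg` at triples that are not admissible
are irrelevant: every triple below is admissible. -/
structure SatisfiesAxioms (deg : (E k → E k) → Set (E k) → E k → ℤ) : Prop where
  normalization : deg id Set.univ 0 = 1
  additivity : ∀ (f : E k → E k) (U U₁ U₂ : Set (E k)) (y : E k),
    Admissible f U y → IsOpen U₁ → IsOpen U₂ → U₁ ⊆ U → U₂ ⊆ U → Disjoint U₁ U₂ →
    solutions f U y ⊆ U₁ ∪ U₂ → deg f U y = deg f U₁ y + deg f U₂ y
  homotopy_invariance : ∀ (H : E k × ℝ → E k) (U : Set (E k)) (α : ℝ → E k),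
    AdmissibleHomotopy H U α →
    deg (fun x => H (x, 0)) U (α 0) = deg (fun x => H (x, 1)) U (α 1)

end BrouwerDegree

namespace BrouwerDegree
variable {k : ℕ}

open Set Metric

/-! The axioms compute the degree of a regular triple. Properness and the inverse-function estimate
make the fibre finite, additivity cuts the domain into small balls around its points, and in each
ball a straight-line homotopy replaces the map by its derivative (`deg_ball_eq_index`). So
everything rests on `deg_lin`: an invertible matrix is a product of transvections, which deform to
the identity, and diagonal matrices, whose entries deform to `1` or `-1`; a reflection flips the
degree by a folding argument (`deg_lin_reflection`).

A general triple inherits the formula from any regular triple joined to it. Straight-line homotopies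
give the nearby ones (`joined_of_near`), and smoothing together with Sard shows that some regular
triple is always near (`exists_regular_near`), whence uniqueness. -/

lemma Admissible.mono_open {f : E k → E k} {U V : Set (E k)} {y : E k} (h : Admissible f U y)
    (hV : IsOpen V) (hVU : V ⊆ U) (hne : ∀ x ∈ frontier V, x ∈ U → f x ≠ y) :
    Admissible f V y := by
  refine ⟨hV, ?_, fun x hx => ?_⟩
  · have hc : closure V ⊆ closure U := closure_mono hVU
    have hi : Topology.IsClosedEmbedding (inclusion hc) :=
      ⟨.inclusion hc, by rw [range_inclusion]; exact isClosed_closure.preimage continuous_subtype_val⟩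
    exact h.2.1.comp hi.isProperMap
  · by_cases hxU : x ∈ U
    · exact hne x hx hxU
    · exact h.2.2 x ⟨closure_mono hVU (frontier_subset_closure hx), by rwa [h.1.interior_eq]⟩

lemma Admissible.of_isBounded {f : E k → E k} {U : Set (E k)} {y : E k} (hU : IsOpen U)
    (hb : Bornology.IsBounded U) (hf : ContinuousOn f (closure U))
    (hne : ∀ x ∈ frontier U, f x ≠ y) : Admissible f U y := by
  have : CompactSpace (closure U) := isCompact_iff_compactSpace.mp hb.isCompact_closure
  exact ⟨hU, (continuousOn_iff_continuous_domRestrict.mp hf).isProperMap, hne⟩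

lemma isProperMap_fst_prod {f : E k → E k} {s : Set (E k)} (hf : IsProperMap (s.domRestrict f)) :
    IsProperMap ((s ×ˢ Icc (0 : ℝ) 1).domRestrict fun p : E k × ℝ => f p.1) :=
  (hf.comp isProperMap_fst_of_compactSpace).comp (Homeomorph.Set.prod s (Icc (0 : ℝ) 1)).isProperMap

/-! ### Formal consequences of the axioms. -/

namespace SatisfiesAxioms

variable {deg : (E k → E k) → Set (E k) → E k → ℤ}

lemma deg_empty (hd : SatisfiesAxioms deg) (f : E k → E k) (y : E k) : deg f ∅ y = 0 := by
  have := hd.additivity f ∅ ∅ ∅ y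
    (.of_isBounded isOpen_empty Bornology.isBounded_empty (by simp) (by simp))
    isOpen_empty isOpen_empty subset_rfl subset_rfl (disjoint_empty _) (by simp [solutions])
  omega

lemma excision (hd : SatisfiesAxioms deg) {f : E k → E k} {U V : Set (E k)} {y : E k}
    (h : Admissible f U y) (hV : IsOpen V) (hVU : V ⊆ U) (hs : solutions f U y ⊆ V) :
    deg f U y = deg f V y := by
  have := hd.additivity f U V ∅ y h hV isOpen_empty hVU (empty_subset _) (disjoint_empty _)
    (by simpa using hs)
  simpa [hd.deg_empty] using this

lemma deg_eq_zero (hd : SatisfiesAxioms deg) {f : E k → E k} {U : Set (E k)} {y : E k}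
    (h : Admissible f U y) (hs : ∀ x ∈ U, f x ≠ y) : deg f U y = 0 := by
  rw [hd.excision h isOpen_empty (empty_subset _), hd.deg_empty]
  exact fun x hx => hs x hx.2 hx.1

/-- The degree depends only on the values on the closure of the domain. -/
lemma congr (hd : SatisfiesAxioms deg) {f g : E k → E k} {U : Set (E k)} {y : E k}
    (h : Admissible f U y) (hfg : EqOn f g (closure U)) : deg f U y = deg g U y := by
  -- The jump at `t = 1` is invisible on `closure U`, where the homotopy is constantly `f`.
  have key := hd.homotopy_invariance (fun p => if p.2 = 1 then g p.1 else f p.1) U (fun _ => y)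
    ⟨h.1, continuousOn_const, ?_, ?_⟩
  · simpa using key
  · convert isProperMap_fst_prod h.2.1 using 1
    ext1 p
    simp only [domRestrict_apply]
    split_ifs
    · exact (hfg p.2.1).symm
    · rfl
  · intro x hx t _
    simp only
    split_ifs
    · rw [← hfg (frontier_subset_closure hx)]; exact h.2.2 x hx
    · exact h.2.2 x hx

lemma homotopy_of_isBounded (hd : SatisfiesAxioms deg) {U : Set (E k)} (hU : IsOpen U)
    (hb : Bornology.IsBounded U) {H : E k × ℝ → E k} {α : ℝ → E k}
    (hH : ContinuousOn H (closure U ×ˢ Icc (0 : ℝ) 1)) (hα : ContinuousOn α (Icc 0 1))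
    (hne : ∀ x ∈ frontier U, ∀ t ∈ Icc (0 : ℝ) 1, H (x, t) ≠ α t) :
    deg (fun x => H (x, 0)) U (α 0) = deg (fun x => H (x, 1)) U (α 1) := by
  have : CompactSpace (closure U ×ˢ Icc (0 : ℝ) 1 : Set (E k × ℝ)) :=
    isCompact_iff_compactSpace.mp (hb.isCompact_closure.prod isCompact_Icc)
  exact hd.homotopy_invariance H U α
    ⟨hU, hα, (continuousOn_iff_continuous_domRestrict.mp hH).isProperMap, hne⟩

end SatisfiesAxioms

/-! ### Matrices as linear maps. -/

/-- The linear endomorphism of `E k` with matrix `M`. -/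
noncomputable def lin (M : Matrix (Fin k) (Fin k) ℝ) : E k →ₗ[ℝ] E k := Matrix.toLpLin 2 2 M

lemma lin_apply (M : Matrix (Fin k) (Fin k) ℝ) (x : E k) :
    lin M x = WithLp.toLp 2 (M.mulVec x.ofLp) := rfl

lemma lin_mul (M N : Matrix (Fin k) (Fin k) ℝ) (x : E k) : lin (M * N) x = lin M (lin N x) := by
  simp [lin_apply]

lemma lin_eq_zero {M : Matrix (Fin k) (Fin k) ℝ} (hM : M.det ≠ 0) {x : E k} :
    lin M x = 0 ↔ x = 0 := by
  refine ⟨fun h => ?_, fun h => by simp [h]⟩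
  rw [lin_apply] at h
  have := Matrix.eq_zero_of_mulVec_eq_zero hM ((WithLp.toLp_eq_zero 2).mp h)
  exact (WithLp.ofLp_eq_zero 2).mp this

lemma continuous_lin {X : Type*} [TopologicalSpace X] {γ : X → Matrix (Fin k) (Fin k) ℝ}
    {f : X → E k} (hγ : Continuous γ) (hf : Continuous f) :
    Continuous fun p => lin (γ p) (f p) := by
  simp only [lin_apply]
  exact (PiLp.continuous_toLp 2 _).comp (hγ.matrix_mulVec ((PiLp.continuous_ofLp 2 _).comp hf))

/-- The diagonal matrix with entry `a` at `i` and `1` elsewhere. -/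
def diagOne (i : Fin k) (a : ℝ) : Matrix (Fin k) (Fin k) ℝ :=
  Matrix.diagonal (Function.update 1 i a)

lemma det_diagOne (i : Fin k) (a : ℝ) : (diagOne i a).det = a := by
  rw [diagOne, Matrix.det_diagonal, Finset.prod_update_of_mem (Finset.mem_univ i)]
  simp

lemma continuous_diagOne (i : Fin k) : Continuous (diagOne i) :=
  (continuous_const.update i continuous_id).matrix_diagonal

lemma lin_diagOne_neg_one (i : Fin k) (v : E k) :
    lin (diagOne i (-1)) v = v - (2 * v i) • EuclideanSpace.single i (1 : ℝ) := by
  ext j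
  rcases eq_or_ne j i with rfl | h
  · simp [lin_apply, diagOne, Matrix.mulVec_diagonal]; ring
  · simp [lin_apply, diagOne, Matrix.mulVec_diagonal, h]

lemma norm_eq_of_mem_frontier_ball {R : ℝ} {x : E k} (hx : x ∈ frontier (ball (0 : E k) R)) :
    ‖x‖ = R := by
  simpa using frontier_ball_subset_sphere hx

/-! ### The degree of invertible linear maps. -/

namespace SatisfiesAxioms

variable {deg : (E k → E k) → Set (E k) → E k → ℤ}

/-- Every invertible affine map has, on every neighborhood of its zero, the degree of its linear
part on the unit ball. -/
lemma deg_affine (hd : SatisfiesAxioms deg) {M : Matrix (Fin k) (Fin k) ℝ} (hM : M.det ≠ 0)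
    {U : Set (E k)} (hU : IsOpen U) (hb : Bornology.IsBounded U) {c : E k} (hc : c ∈ U) :
    deg (fun x => lin M (x - c)) U 0 = deg (lin M) (ball 0 1) 0 := by
  obtain ⟨R, hR, hUR⟩ := hb.subset_ball_lt 1 0
  have hcR : ‖c‖ < R := by simpa using hUR hc
  have hadm : ∀ b : E k, ‖b‖ < R → Admissible (fun x => lin M (x - b)) (ball 0 R) 0 := by
    intro b hbR
    refine .of_isBounded isOpen_ball isBounded_ball
      (continuous_lin continuous_const (by fun_prop)).continuousOn fun x hx h => ?_
    have := norm_eq_of_mem_frontier_ball hx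
    rw [lin_eq_zero hM, sub_eq_zero] at h
    exact hbR.ne (h ▸ this)
  have h1 : deg (fun x => lin M (x - c)) (ball 0 R) 0 = deg (fun x => lin M (x - c)) U 0 := by
    refine hd.excision (hadm c hcR) hU hUR fun x hx => ?_
    have h : lin M (x - c) = 0 := hx.1
    rw [lin_eq_zero hM, sub_eq_zero] at h
    exact h ▸ hc
  have h2 : deg (fun x => lin M (x - 0)) (ball 0 R) 0
      = deg (fun x => lin M (x - 0)) (ball 0 1) 0 := by
    refine hd.excision (hadm 0 (by simp; linarith)) isOpen_ball (ball_subset_ball hR.le)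
      fun x hx => ?_
    have h : lin M (x - 0) = 0 := hx.1
    rw [lin_eq_zero hM, sub_eq_zero] at h
    simp [h]
  -- The zero slides from `0` to `c` along `t • c`, staying inside the large ball.
  have h3 := hd.homotopy_of_isBounded (U := ball 0 R) isOpen_ball isBounded_ball
    (H := fun p => lin M (p.1 - p.2 • c)) (α := fun _ => 0)
    (continuous_lin continuous_const (by fun_prop)).continuousOn continuousOn_const ?_
  · simp only [zero_smul, one_smul] at h3
    rw [← h1, ← h3, h2]
    simp only [sub_zero]
  · intro x hx t ht h
    rw [lin_eq_zero hM, sub_eq_zero] at h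
    have h5 := norm_eq_of_mem_frontier_ball hx
    have h6 : x = t • c := h
    rw [h6, norm_smul, Real.norm_of_nonneg ht.1] at h5
    nlinarith [mul_le_mul_of_nonneg_right ht.2 (norm_nonneg c)]

lemma deg_lin_path (hd : SatisfiesAxioms deg) {γ : ℝ → Matrix (Fin k) (Fin k) ℝ}
    (hγ : Continuous γ) (hdet : ∀ t ∈ Icc (0 : ℝ) 1, (γ t).det ≠ 0) :
    deg (lin (γ 0)) (ball 0 1) 0 = deg (lin (γ 1)) (ball 0 1) 0 := by
  refine hd.homotopy_of_isBounded (U := ball 0 1) isOpen_ball isBounded_ball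
    (H := fun p => lin (γ p.2) p.1) (α := fun _ => 0)
    (continuous_lin (by fun_prop) (by fun_prop)).continuousOn continuousOn_const ?_
  intro x hx t ht h
  rw [lin_eq_zero (hdet t ht)] at h
  have h1 := norm_eq_of_mem_frontier_ball hx
  have h2 : x = 0 := h
  simp [h2] at h1

/-- Composition with a reflection changes the sign of the degree, as one sees by folding the space
along a hyperplane. -/
lemma deg_lin_reflection (hd : SatisfiesAxioms deg) (i : Fin k) {B : Matrix (Fin k) (Fin k) ℝ}
    (hB : B.det ≠ 0) : deg (lin (diagOne i (-1) * B)) (ball 0 1) 0 = -deg (lin B) (ball 0 1) 0 := by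
  set e : E k := EuclideanSpace.single i (1 : ℝ) with he
  obtain ⟨c, hc⟩ : ∃ c, lin B c = e := ⟨lin B⁻¹ e, by
    rw [← lin_mul, Matrix.mul_nonsing_inv _ hB.isUnit]; simp [lin_apply]⟩
  obtain ⟨R, hR⟩ := exists_gt ‖c‖
  have hR0 : 0 < R := (norm_nonneg c).trans_lt hR
  -- The `i`-th coordinate of `F (x, t)` is `|(B x) i| - 1 + 2 t`. At `t = 1` there is no zero; at
  -- `t = 0` the zeros are `c` and `-c`, where `F` is `B (x - c)` on one half-space and the
  -- reflection of `B (x + c)` on the other. Any zero is `s • c` with `|s| ≤ 1`, hence `R > ‖c‖`.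
  set F : E k × ℝ → E k := fun p =>
    lin B p.1 + (|lin B p.1 i| - lin B p.1 i - 1 + 2 * p.2) • e with hF
  have hcB : Continuous fun x : E k => lin B x := continuous_lin continuous_const continuous_id
  have hcBi : Continuous fun x : E k => lin B x i := by fun_prop
  have hFc : Continuous F := by fun_prop
  have hFi : ∀ p, F p i = |lin B p.1 i| - 1 + 2 * p.2 := fun p => by simp [hF, he]; ring
  have hF0 : ∀ x ∈ frontier (ball (0 : E k) R), ∀ t ∈ Icc (0 : ℝ) 1, F (x, t) ≠ 0 := by
    intro x hx t ht h
    have h1 : |lin B x i| - 1 + 2 * t = 0 := by rw [← hFi (x, t), h]; rfl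
    have h2 : lin B x = (lin B x i) • e := by
      have : (|lin B x i| - lin B x i - 1 + 2 * t) = - lin B x i := by linarith
      simp only [hF, this, neg_smul] at h
      exact add_neg_eq_zero.mp h
    have h3 : x = (lin B x i) • c := by
      rw [← sub_eq_zero, ← lin_eq_zero hB, map_sub, map_smul, hc, ← h2, sub_self]
    have h4 := norm_eq_of_mem_frontier_ball hx
    rw [h3, norm_smul, Real.norm_eq_abs] at h4
    have h5 : |lin B x i| ≤ 1 := by linarith [ht.1]
    nlinarith [mul_le_mul_of_nonneg_right h5 (norm_nonneg c)]
  have hzero : deg (fun x => F (x, 0)) (ball 0 R) 0 = 0 := by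
    rw [hd.homotopy_of_isBounded (U := ball 0 R) isOpen_ball isBounded_ball (H := F)
      (α := fun _ => 0) hFc.continuousOn continuousOn_const hF0]
    refine hd.deg_eq_zero (.of_isBounded isOpen_ball isBounded_ball
      (by fun_prop) fun x hx => hF0 x hx 1 (by simp)) fun x _ h => ?_
    have h1 : |lin B x i| - 1 + 2 * 1 = 0 := by rw [← hFi (x, 1), h]; rfl
    linarith [abs_nonneg (lin B x i)]
  have hadm : Admissible (fun x => F (x, 0)) (ball 0 R) 0 :=
    .of_isBounded isOpen_ball isBounded_ball (by fun_prop) fun x hx => hF0 x hx 0 (by simp)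
  set U₁ : Set (E k) := {x | 0 < lin B x i} ∩ ball 0 R
  set U₂ : Set (E k) := {x | lin B x i < 0} ∩ ball 0 R
  have hU₁ : IsOpen U₁ := (isOpen_lt continuous_const hcBi).inter isOpen_ball
  have hU₂ : IsOpen U₂ := (isOpen_lt hcBi continuous_const).inter isOpen_ball
  have hdisj : Disjoint U₁ U₂ := by
    rw [Set.disjoint_left]
    intro x h1 h2
    exact lt_asymm (show 0 < lin B x i from h1.1) h2.1
  have hne : ∀ x, F (x, 0) = 0 → lin B x i ≠ 0 := by
    intro x hx h
    have := hFi (x, 0)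
    rw [hx] at this
    simp [h] at this
  have hsum := hd.additivity _ _ U₁ U₂ 0 hadm hU₁ hU₂ inter_subset_right inter_subset_right hdisj
    fun x hx => (hne x hx.1).lt_or_gt.elim (fun h => .inr ⟨h, hx.2⟩) fun h => .inl ⟨h, hx.2⟩
  have hc1 : lin B c i = 1 := by simp [hc, he]
  have e1 : deg (fun x => F (x, 0)) U₁ 0 = deg (lin B) (ball 0 1) 0 := by
    rw [← hd.deg_affine hB hU₁ (isBounded_ball.subset inter_subset_right) (c := c)
      ⟨by simp [hc1], by simpa using hR⟩]
    refine hd.congr (hadm.mono_open hU₁ inter_subset_right ?_) ?_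
    · intro x hx hxR h
      rcases (hne x h).lt_or_gt with h' | h'
      · exact (hdisj.symm.closure_right hU₂).notMem_of_mem_left ⟨h', hxR⟩
          (frontier_subset_closure hx)
      · exact hx.2 (hU₁.interior_eq.symm ▸ ⟨h', hxR⟩)
    · intro x hx
      have hx0 : 0 ≤ lin B x i :=
        closure_minimal (fun x hx => le_of_lt (show 0 < lin B x i from hx.1))
          (isClosed_le continuous_const hcBi) hx
      simp [hF, abs_of_nonneg hx0, hc, sub_eq_add_neg]
  have e2 : deg (fun x => F (x, 0)) U₂ 0 = deg (lin (diagOne i (-1) * B)) (ball 0 1) 0 := by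
    rw [← hd.deg_affine (by simp [det_diagOne, hB]) hU₂ (isBounded_ball.subset inter_subset_right)
      (c := -c) ⟨by simp [hc1], by simpa using hR⟩]
    refine hd.congr (hadm.mono_open hU₂ inter_subset_right ?_) ?_
    · intro x hx hxR h
      rcases (hne x h).lt_or_gt with h' | h'
      · exact hx.2 (hU₂.interior_eq.symm ▸ ⟨h', hxR⟩)
      · exact (hdisj.closure_right hU₁).notMem_of_mem_left ⟨h', hxR⟩
          (frontier_subset_closure hx)
    · intro x hx
      have hx0 : lin B x i ≤ 0 :=
        closure_minimal (fun x hx => le_of_lt (show lin B x i < 0 from hx.1))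
          (isClosed_le hcBi continuous_const) hx
      simp only [hF, abs_of_nonpos hx0, lin_mul, map_sub, map_neg, hc, lin_diagOne_neg_one, ← he]
      have : e i = 1 := by simp [he]
      rw [this]
      module
  linarith

/-- The entry `a` moves along a segment to `1` or `-1` without crossing `0`; only `-1` costs a
reflection. -/
lemma deg_lin_diagOne (hd : SatisfiesAxioms deg) (i : Fin k) {a : ℝ} (ha : a ≠ 0)
    {B : Matrix (Fin k) (Fin k) ℝ} (hB : B.det ≠ 0) :
    deg (lin (diagOne i a * B)) (ball 0 1) 0
      = (SignType.sign a : ℤ) * deg (lin B) (ball 0 1) 0 := by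
  have hone : diagOne i 1 = 1 := by simp [diagOne]
  have hpath : ∀ b : ℝ, (∀ t ∈ Icc (0 : ℝ) 1, (1 - t) * a + t * b ≠ 0) →
      deg (lin (diagOne i a * B)) (ball 0 1) 0 = deg (lin (diagOne i b * B)) (ball 0 1) 0 := by
    intro b hb
    have := hd.deg_lin_path (γ := fun t => diagOne i ((1 - t) * a + t * b) * B)
      (((continuous_diagOne i).comp (by fun_prop)).matrix_mul continuous_const)
      fun t ht => by simpa [det_diagOne, hB] using hb t ht
    simpa using this
  rcases ha.lt_or_gt with ha | ha
  · rw [hpath (-1) fun t ht h => ?_, hd.deg_lin_reflection i hB]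
    · simp [ha]
    · have h1 := mul_nonneg (sub_nonneg.mpr ht.2) (neg_nonneg.mpr ha.le)
      have h2 : t = 0 := by linarith [ht.1]
      subst h2
      linarith
  · rw [hpath 1 fun t ht h => ?_, hone]
    · simp [ha]
    · have h1 := mul_nonneg (sub_nonneg.mpr ht.2) ha.le
      have h2 : t = 0 := by linarith [ht.1]
      subst h2
      linarith

/-- The degree of an invertible linear map is the sign of its determinant. -/
lemma deg_lin (hd : SatisfiesAxioms deg) {A : Matrix (Fin k) (Fin k) ℝ} (hA : A.det ≠ 0) :
    deg (lin A) (ball 0 1) 0 = (SignType.sign A.det : ℤ) := by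
  -- The free right factor `B` makes the claim pass to products in `A`.
  have key : ∀ B : Matrix (Fin k) (Fin k) ℝ, B.det ≠ 0 → deg (lin (A * B)) (ball 0 1) 0
      = (SignType.sign A.det : ℤ) * deg (lin B) (ball 0 1) 0 := by
    refine Matrix.diagonal_transvection_induction_of_det_ne_zero
      (fun A => ∀ B : Matrix (Fin k) (Fin k) ℝ, B.det ≠ 0 → deg (lin (A * B)) (ball 0 1) 0
        = (SignType.sign A.det : ℤ) * deg (lin B) (ball 0 1) 0) A hA ?_ ?_ ?_
    · intro d hdet
      have hdi : ∀ i, d i ≠ 0 := by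
        simpa [Matrix.det_diagonal, Finset.prod_ne_zero_iff] using hdet
      have hs : ∀ s : Finset (Fin k), ∀ B : Matrix (Fin k) (Fin k) ℝ, B.det ≠ 0 →
          deg (lin (Matrix.diagonal (fun i => if i ∈ s then d i else 1) * B)) (ball 0 1) 0
            = (SignType.sign (∏ i ∈ s, d i) : ℤ) * deg (lin B) (ball 0 1) 0 := by
        intro s
        induction s using Finset.induction_on with
        | empty => intro B _; simp
        | insert a s ha ih =>
          intro B hB
          have : Matrix.diagonal (fun i => if i ∈ insert a s then d i else 1)
              = diagOne a (d a) * Matrix.diagonal (fun i => if i ∈ s then d i else 1) := by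
            rw [diagOne, Matrix.diagonal_mul_diagonal]
            congr 1
            ext i
            rcases eq_or_ne i a with rfl | h <;> simp [*]
          rw [this, Matrix.mul_assoc, hd.deg_lin_diagOne a (hdi a), ih B hB,
            Finset.prod_insert ha, sign_mul]
          · push_cast; ring
          · rw [Matrix.det_mul, Matrix.det_diagonal]
            refine mul_ne_zero (Finset.prod_ne_zero_iff.mpr fun i _ => ?_) hB
            split_ifs
            · exact hdi i
            · exact one_ne_zero
      intro B hB
      simpa [Matrix.det_diagonal] using hs Finset.univ B hB
    · intro t B hB
      -- Scaling the off-diagonal entry down to `0` keeps the determinant of the transvection equal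
      -- to `1`.
      have := hd.deg_lin_path (γ := fun s => Matrix.transvection t.i t.j (s * t.c) * B)
        ?_ fun s _ => by simpa [Matrix.det_transvection_of_ne _ _ t.hij] using hB
      · have h1 : Matrix.transvection t.i t.j t.c = t.toMatrix := rfl
        simp only [zero_mul, one_mul, Matrix.transvection_zero, h1] at this
        simp [← this]
      · unfold Matrix.transvection
        refine Continuous.matrix_mul (continuous_const.add ?_) continuous_const
        refine continuous_matrix fun a b => ?_
        simp only [Matrix.single_apply]
        split_ifs <;> fun_prop
    · intro A A' hA hA' ih ih' B hB
      rw [Matrix.mul_assoc, ih _ (by simp [hA', hB]), ih' B hB, Matrix.det_mul, sign_mul]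
      push_cast; ring
  have h1 : deg (lin (1 : Matrix (Fin k) (Fin k) ℝ)) (ball 0 1) 0 = 1 := by
    have hl : (lin (1 : Matrix (Fin k) (Fin k) ℝ) : E k → E k) = id := by
      ext1 x; simp [lin_apply]
    rw [hl, ← hd.normalization]
    refine (hd.excision ⟨isOpen_univ, ?_, by simp⟩ isOpen_ball (subset_univ _) ?_).symm
    · have : IsClosed (closure (univ : Set (E k))) := isClosed_closure
      exact this.isClosedEmbedding_subtypeVal.isProperMap
    · intro x hx
      have : x = 0 := hx.1
      simp [this]
  simpa [h1] using key 1 (by simp)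

end SatisfiesAxioms
-- Linearization at regular points and finiteness of the fibre.
lemma exists_matrix (A : E k →L[ℝ] E k) :
    ∃ M : Matrix (Fin k) (Fin k) ℝ, (∀ x, lin M x = A x) ∧ M.det = A.det := by
  refine ⟨(Matrix.toLpLin 2 2).symm (A : E k →ₗ[ℝ] E k), fun x => ?_, ?_⟩
  · simp [lin]
  · rw [← LinearMap.det_toLin (PiLp.basisFun 2 ℝ (Fin k)), ← Matrix.toLpLin_eq_toLin,
      LinearEquiv.apply_symm_apply]

lemma exists_mul_norm_le {A : E k →L[ℝ] E k} (hA : A.det ≠ 0) :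
    ∃ c > 0, ∀ v, c * ‖v‖ ≤ ‖A v‖ := by
  have hinj : LinearMap.ker (A : E k →ₗ[ℝ] E k) = ⊥ := by
    by_contra h
    exact hA (LinearMap.det_eq_zero_iff_ker_ne_bot.mpr h)
  obtain ⟨K, hK, h⟩ := LinearMap.exists_antilipschitzWith (A : E k →ₗ[ℝ] E k) hinj
  refine ⟨(K : ℝ)⁻¹, by positivity, fun v => ?_⟩
  rw [inv_mul_le_iff₀ (by positivity)]
  simpa using h.le_mul_dist v 0

lemma surjective_iff_det_ne_zero (A : E k →L[ℝ] E k) :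
    Function.Surjective A ↔ A.det ≠ 0 := by
  have h1 : Function.Surjective A ↔ LinearMap.range (A : E k →ₗ[ℝ] E k) = ⊤ :=
    LinearMap.range_eq_top.symm
  have h2 : A.det = LinearMap.det (A : E k →ₗ[ℝ] E k) := rfl
  rw [h1, ← LinearMap.ker_eq_bot_iff_range_eq_top, h2, ne_eq,
    LinearMap.det_eq_zero_iff_ker_ne_bot, not_not]

/-- Near a point where the derivative is invertible, the remainder of the first order expansion is
smaller than the derivative. -/
lemma exists_norm_sub_lt {g : E k → E k} {x : E k} (hg : DifferentiableAt ℝ g x)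
    (hdet : (fderiv ℝ g x).det ≠ 0) : ∃ r > 0, ∀ x' ∈ closedBall x r, x' ≠ x →
      ‖g x' - g x - fderiv ℝ g x (x' - x)‖ < ‖fderiv ℝ g x (x' - x)‖ := by
  obtain ⟨c, hc, hA⟩ := exists_mul_norm_le hdet
  -- Half the lower bound of the derivative suffices for a strict inequality.
  have := hg.hasFDerivAt.isLittleO.def (half_pos hc)
  obtain ⟨r, hr, h⟩ := nhds_basis_closedBall.eventually_iff.mp this
  refine ⟨r, hr, fun x' hx' hne => (h hx').trans_lt ?_⟩
  have : 0 < ‖x' - x‖ := norm_pos_iff.mpr (sub_ne_zero.mpr hne)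
  nlinarith [hA (x' - x)]

/-- Rouché's condition: the segment from `a` to `b` stays closer to `b` than `0` is. -/
lemma ne_of_norm_sub_lt {a b : E k} (h : ‖a - b‖ < ‖b‖) {t : ℝ} (ht : t ∈ Icc (0 : ℝ) 1) :
    (1 - t) • a + t • b ≠ 0 := by
  intro h0
  have h1 : b = -((1 - t) • (a - b)) := by
    rw [← sub_eq_zero, ← h0]; module
  have h2 : ‖b‖ = (1 - t) * ‖a - b‖ := by
    conv_lhs => rw [h1, norm_neg, norm_smul, Real.norm_of_nonneg (by linarith [ht.2])]
  nlinarith [norm_nonneg (a - b), ht.1]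

/-- The fibre is compact by properness, no solution lying on the boundary, and discrete because a
second solution near `x` would violate the strict bound of `exists_norm_sub_lt`. -/
lemma finite_solutions {g : E k → E k} {U : Set (E k)} {z : E k} (h : Admissible g U z)
    (hg : ∀ x ∈ solutions g U z, DifferentiableAt ℝ g x ∧ (fderiv ℝ g x).det ≠ 0) :
    (solutions g U z).Finite := by
  have hcomp : IsCompact (solutions g U z) := by
    have h1 := (h.2.1.isCompact_preimage (isCompact_singleton (x := z))).image
      continuous_subtype_val
    convert h1 using 1
    ext x
    simp only [solutions, mem_inter_iff, mem_preimage, mem_singleton_iff, mem_image,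
      domRestrict_apply, Subtype.exists, exists_and_left, exists_prop, exists_eq_right_right]
    refine and_congr_right fun hx => ⟨fun hxU => subset_closure hxU, fun hxU => ?_⟩
    by_contra hn
    exact h.2.2 x ⟨hxU, by rwa [h.1.interior_eq]⟩ hx
  refine hcomp.finite (isDiscrete_iff_forall_mem_exists_isOpen.mpr fun x hx => ?_)
  obtain ⟨r, hr, hlt⟩ := exists_norm_sub_lt (hg x hx).1 (hg x hx).2
  refine ⟨ball x r, isOpen_ball, ?_⟩
  ext x'
  simp only [mem_inter_iff, mem_singleton_iff]
  refine ⟨fun h' => ?_, by rintro rfl; exact ⟨mem_ball_self hr, hx⟩⟩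
  by_contra hne
  have h1 := hlt x' (ball_subset_closedBall h'.1) hne
  have h2 : g x' = z := h'.2.1
  have h3 : g x = z := hx.1
  simp [-map_sub, h2, h3] at h1

/-! ### The degree of a regular triple. -/

namespace SatisfiesAxioms

variable {deg : (E k → E k) → Set (E k) → E k → ℤ}

lemma deg_ball_eq_index (hd : SatisfiesAxioms deg) {g : E k → E k} {x : E k} {r : ℝ}
    (hr : 0 < r) (hc : ContinuousOn g (closedBall x r)) (hdet : (fderiv ℝ g x).det ≠ 0)
    (hlt : ∀ x' ∈ closedBall x r, x' ≠ x →
      ‖g x' - g x - fderiv ℝ g x (x' - x)‖ < ‖fderiv ℝ g x (x' - x)‖) :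
    deg g (ball x r) (g x) = index g x := by
  obtain ⟨M, hM, hMdet⟩ := exists_matrix (fderiv ℝ g x)
  have hcl : closure (ball x r) = closedBall x r := closure_ball x hr.ne'
  -- The target moves from `g x` to `0`, so that map minus target is the segment from `g x' - g x`
  -- to its linear part.
  have key := hd.homotopy_of_isBounded (U := ball x r) isOpen_ball isBounded_ball
    (H := fun p => (1 - p.2) • g p.1 + p.2 • fderiv ℝ g x (p.1 - x))
    (α := fun t => (1 - t) • g x) ?_ (by fun_prop) ?_
  · simp only [sub_zero, one_smul, zero_smul, add_zero, sub_self, zero_add, ← hM] at key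
    rw [key, hd.deg_affine (hMdet ▸ hdet) isOpen_ball isBounded_ball (mem_ball_self hr),
      hd.deg_lin (hMdet ▸ hdet), hMdet, index]
  · rw [hcl]
    have : ContinuousOn (fun p : E k × ℝ => g p.1) (closedBall x r ×ˢ Icc (0 : ℝ) 1) :=
      hc.comp continuousOn_fst fun p hp => hp.1
    exact ((continuousOn_const.sub continuousOn_snd).smul this).add (by fun_prop)
  · intro x' hx' t ht h
    have hx2 : x' ∈ sphere x r := frontier_ball_subset_sphere hx'
    have hne : x' ≠ x := by
      rintro rfl
      simp at hx2
      exact hr.ne hx2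
    refine ne_of_norm_sub_lt (hlt x' (sphere_subset_closedBall hx2) hne) ht ?_
    rw [smul_sub, sub_add_eq_add_sub, sub_eq_zero]
    exact h

/-- Induction on the fibre with `U` free: a small ball isolates one solution, and the rest lie in
`U` minus the closed ball. -/
lemma deg_eq_sum_index (hd : SatisfiesAxioms deg) {g : E k → E k} {z : E k} (S : Finset (E k))
    (hS : ∀ x ∈ S, DifferentiableAt ℝ g x ∧ (fderiv ℝ g x).det ≠ 0) :
    ∀ U : Set (E k), Admissible g U z → solutions g U z = S →
      deg g U z = ∑ x ∈ S, index g x := by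
  induction S using Finset.induction_on with
  | empty =>
    intro U hU hsol
    rw [Finset.sum_empty]
    refine hd.deg_eq_zero hU fun x hx h => ?_
    have : x ∈ solutions g U z := ⟨h, hx⟩
    simp [hsol] at this
  | insert x S hxS ih =>
    intro U hU hsol
    have hx : x ∈ solutions g U z := hsol ▸ (by simp)
    have hgx : g x = z := hx.1
    obtain ⟨hdiff, hdet⟩ := hS x (by simp)
    obtain ⟨r₁, hr₁, hlt⟩ := exists_norm_sub_lt hdiff hdet
    obtain ⟨r₂, hr₂, hsub⟩ := nhds_basis_closedBall.mem_iff.mp (hU.1.mem_nhds hx.2)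
    have hr : 0 < min r₁ r₂ := lt_min hr₁ hr₂
    set r := min r₁ r₂
    have hrU : closedBall x r ⊆ U := (closedBall_subset_closedBall (min_le_right _ _)).trans hsub
    have hr1 : closedBall x r ⊆ closedBall x r₁ := closedBall_subset_closedBall (min_le_left _ _)
    have huniq : ∀ x' ∈ closedBall x r, g x' = z → x' = x := by
      intro x' hx' h
      by_contra hne
      have := hlt x' (hr1 hx') hne
      simp [-map_sub, h, hgx] at this
    have hopen : IsOpen (U \ closedBall x r) := hU.1.sdiff isClosed_closedBall
    have hcover : solutions g U z ⊆ ball x r ∪ U \ closedBall x r := by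
      intro x' hx'
      by_cases h : x' ∈ closedBall x r
      · left
        rw [huniq x' h hx'.1]
        exact mem_ball_self hr
      · exact .inr ⟨hx'.2, h⟩
    have hc : ContinuousOn g (closure U) := continuousOn_iff_continuous_domRestrict.mpr
      hU.2.1.continuous
    rw [hd.additivity g U (ball x r) (U \ closedBall x r) z hU isOpen_ball hopen
      (ball_subset_closedBall.trans hrU) sdiff_subset
      (disjoint_sdiff_right.mono_left ball_subset_closedBall) hcover, Finset.sum_insert hxS]
    congr 1
    · rw [← hgx]
      exact hd.deg_ball_eq_index hr (hc.mono (hrU.trans subset_closure)) hdet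
        fun x' hx' => hlt x' (hr1 hx')
    · refine ih (fun x' hx' => hS x' (by simp [hx'])) _ (hU.mono_open hopen sdiff_subset ?_) ?_
      · intro x' hx' hxU h
        have hx2 : x' ∈ closedBall x r := by
          by_contra hn
          exact hx'.2 (hopen.interior_eq.symm ▸ ⟨hxU, hn⟩)
        have hx3 := huniq x' hx2 h
        subst hx3
        exact (disjoint_sdiff_right.mono_left ball_subset_closedBall).symm.closure_left isOpen_ball
          |>.notMem_of_mem_left (frontier_subset_closure hx') (mem_ball_self hr)
      · ext x'
        constructor
        · rintro ⟨h1, h2, h3⟩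
          have : x' ∈ solutions g U z := ⟨h1, h2⟩
          rw [hsol, Finset.coe_insert] at this
          refine this.resolve_left ?_
          rintro rfl
          exact h3 (mem_closedBall_self hr.le)
        · intro h
          have h1 : x' ∈ solutions g U z := by rw [hsol]; simp [Finset.mem_coe.mp h]
          refine ⟨h1.1, h1.2, fun h3 => ?_⟩
          rw [huniq x' h3 h1.1] at h
          exact hxS h

end SatisfiesAxioms

/-- Solutions lie in the open set `U`, where `g` agrees with its smooth extension; values off
`closure U` do not matter. -/
lemma Regular.differentiableAt {g : E k → E k} {U : Set (E k)} {z : E k} (h : Regular g U z) :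
    ∀ x ∈ solutions g U z, DifferentiableAt ℝ g x ∧ (fderiv ℝ g x).det ≠ 0 := by
  intro x hx
  obtain ⟨V, hV, hUV, F, hF, hFg⟩ := h.2.1
  have hxU : U ∈ nhds x := h.1.1.mem_nhds hx.2
  have hFx : DifferentiableAt ℝ F x :=
    (hF.contDiffAt (hV.mem_nhds (hUV (subset_closure hx.2)))).differentiableAt (by simp)
  have : F =ᶠ[nhds x] g := Filter.eventually_of_mem hxU fun x' hx' => hFg (subset_closure hx')
  exact ⟨hFx.congr_of_eventuallyEq this.symm,
    (surjective_iff_det_ne_zero _).mp (h.2.2 x hx.2 hx.1)⟩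

lemma SatisfiesAxioms.deg_regular {deg : (E k → E k) → Set (E k) → E k → ℤ}
    (hd : SatisfiesAxioms deg) {g : E k → E k} {U : Set (E k)} {z : E k} (h : Regular g U z) :
    (solutions g U z).Finite ∧ deg g U z = ∑ᶠ x ∈ solutions g U z, index g x := by
  have hfin := finite_solutions h.1 h.differentiableAt
  refine ⟨hfin, ?_⟩
  rw [finsum_mem_eq_finite_toFinset_sum _ hfin]
  exact hd.deg_eq_sum_index _ (fun x hx => h.differentiableAt x (hfin.mem_toFinset.mp hx)) U h.1
    (by simp)

lemma SatisfiesAxioms.deg_eq_of_joined {deg : (E k → E k) → Set (E k) → E k → ℤ}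
    (hd : SatisfiesAxioms deg) {f g : E k → E k} {U : Set (E k)} {y z : E k}
    (hf : Admissible f U y) (hg : Admissible g U z)
    (hj : JoinedByAdmissibleHomotopy U g z f y) : deg f U y = deg g U z := by
  obtain ⟨H, α, hH, h0, rfl, h1, rfl⟩ := hj
  rw [hd.congr hf h1.symm, hd.congr hg h0.symm]
  exact (hd.homotopy_invariance H U α hH).symm

/-! ### Perturbation and approximation by regular triples. -/

/-- The `p`-preimage of `K` lies in the `q`-preimage of the closed `ε`-thickening of `K`, which is
compact. -/
lemma isProperMap_of_dist_le {X : Type*} [TopologicalSpace X] {p q : X → E k} {ε : ℝ}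
    (hq : IsProperMap q) (hp : Continuous p) (h : ∀ x, dist (p x) (q x) ≤ ε) : IsProperMap p := by
  rw [isProperMap_iff_isCompact_preimage]
  refine ⟨hp, fun K hK => ?_⟩
  refine (hq.isCompact_preimage (hK.cthickening (r := ε))).of_isClosed_subset
    (hK.isClosed.preimage hp) fun x hx => ?_
  exact mem_cthickening_of_dist_le _ (p x) _ _ hx (by rw [dist_comm]; exact h x)

/-- Map and target both move along segments; meeting on the boundary would put some `f x` within `ε
+ σ` of `y`. With `infEDist`, an empty boundary is at infinite distance. -/
lemma joined_of_near {f g : E k → E k} {U : Set (E k)} {y z : E k} {ε σ : ℝ}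
    (hf : Admissible f U y) (hg : ContinuousOn g (closure U))
    (hfg : ∀ x ∈ closure U, ‖g x - f x‖ ≤ ε) (hyz : ‖z - y‖ ≤ σ)
    (hlt : ENNReal.ofReal (ε + σ) < infEDist y (f '' frontier U)) :
    JoinedByAdmissibleHomotopy U g z f y := by
  have hfc : ContinuousOn f (closure U) :=
    continuousOn_iff_continuous_domRestrict.mpr hf.2.1.continuous
  refine ⟨fun p => f p.1 + (1 - p.2) • (g p.1 - f p.1), fun t => y + (1 - t) • (z - y),
    ⟨hf.1, by fun_prop, ?_, ?_⟩, fun x _ => by simp, by simp, fun x _ => by simp, by simp⟩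
  · refine isProperMap_of_dist_le (isProperMap_fst_prod hf.2.1) (ε := ε) ?_ ?_
    · rw [← continuousOn_iff_continuous_domRestrict]
      have h1 : ContinuousOn (fun p : E k × ℝ => f p.1) (closure U ×ˢ Icc (0 : ℝ) 1) :=
        hfc.comp continuousOn_fst fun p hp => hp.1
      have h2 : ContinuousOn (fun p : E k × ℝ => g p.1) (closure U ×ˢ Icc (0 : ℝ) 1) :=
        hg.comp continuousOn_fst fun p hp => hp.1
      exact h1.add ((continuousOn_const.sub continuousOn_snd).smul (h2.sub h1))
    · rintro ⟨⟨x, t⟩, hx, ht⟩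
      have h1 : ‖(1 - t) • (g x - f x)‖ ≤ ε := by
        rw [norm_smul, Real.norm_of_nonneg (by linarith [ht.2])]
        nlinarith [hfg x hx, norm_nonneg (g x - f x), ht.1]
      simpa [dist_eq_norm] using h1
  · intro x hx t ht h
    have h1 : f x - y = (1 - t) • ((z - y) - (g x - f x)) := by
      have h2 : f x + (1 - t) • (g x - f x) - (y + (1 - t) • (z - y)) = 0 := sub_eq_zero.mpr h
      rw [← sub_eq_zero, ← h2]; module
    have h2 : ‖f x - y‖ ≤ ε + σ := by
      rw [h1, norm_smul, Real.norm_of_nonneg (by linarith [ht.2])]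
      have := norm_sub_le (z - y) (g x - f x)
      nlinarith [hfg x (frontier_subset_closure hx), norm_nonneg ((z - y) - (g x - f x)), ht.1]
    refine hlt.not_ge ((infEDist_le_edist_of_mem (mem_image_of_mem f hx)).trans ?_)
    rw [edist_dist, dist_comm, dist_eq_norm]
    exact ENNReal.ofReal_le_ofReal h2

lemma exists_regular_near {f : E k → E k} {U : Set (E k)} {y : E k} (hf : Admissible f U y) :
    ∃ (g : E k → E k) (z : E k), Regular g U z ∧ JoinedByAdmissibleHomotopy U g z f y := by
  have hfc : ContinuousOn f (closure U) :=
    continuousOn_iff_continuous_domRestrict.mpr hf.2.1.continuous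
  obtain ⟨δ, hδ, hlt⟩ : ∃ δ > 0, ENNReal.ofReal δ < infEDist y (f '' frontier U) := by
    -- Proper maps are closed, so `y` has positive distance from the image of the boundary.
    have hcl : IsClosed (f '' frontier U) := by
      have := hf.2.1.isClosedMap _ ((isClosed_frontier (s := U)).preimage
        (continuous_subtype_val : Continuous (Subtype.val : closure U → E k)))
      convert this using 1
      ext v
      simp only [mem_image, mem_preimage, domRestrict_apply, Subtype.exists]
      exact ⟨fun ⟨x, hx, h⟩ => ⟨x, frontier_subset_closure hx, hx, h⟩,
        fun ⟨x, _, hx, h⟩ => ⟨x, hx, h⟩⟩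
    refine exists_real_pos_lt_infEDist_of_notMem_closure ?_
    rw [hcl.closure_eq]
    rintro ⟨x, hx, h⟩
    exact hf.2.2 x hx h
  -- Smoothing applies to maps continuous on the whole space.
  have : TietzeExtension (E k) := TietzeExtension.of_tvs ℝ
  obtain ⟨F, hF⟩ := ContinuousMap.exists_restrict_eq (isClosed_closure (s := U))
    ⟨_, hf.2.1.continuous⟩
  have hFf : ∀ x ∈ closure U, F x = f x := fun x hx => congrArg (fun φ => φ ⟨x, hx⟩) hF
  obtain ⟨g, hg, hgF, -⟩ := F.continuous.exists_contDiff_approx (F := E k) ⊤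
    (ε := fun _ => δ / 2) continuous_const fun _ => half_pos hδ
  have hdg : Differentiable ℝ g := hg.differentiable (by simp)
  have hgf : ∀ x ∈ closure U, ‖g x - f x‖ ≤ δ / 2 := by
    intro x hx
    rw [← hFf x hx, ← dist_eq_norm]
    exact (hgF x).le
  -- Sard in equal dimensions: critical values form a null set, which cannot contain a ball. Map and
  -- target each use half of `δ`.
  obtain ⟨z, hzy, hz⟩ : ∃ z ∈ ball y (δ / 2), z ∉ g '' {x | (fderiv ℝ g x).det = 0} := by
    by_contra! h
    have h0 : MeasureTheory.volume (g '' {x | (fderiv ℝ g x).det = 0}) = 0 :=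
      MeasureTheory.addHaar_image_eq_zero_of_det_fderivWithin_eq_zero _
        (fun x _ => (hdg x).hasFDerivAt.hasFDerivWithinAt) fun x hx => hx
    exact (measure_ball_pos MeasureTheory.volume y (half_pos hδ)).ne'
      (MeasureTheory.measure_mono_null h h0)
  have hzy' : ‖z - y‖ ≤ δ / 2 := by rw [← dist_eq_norm]; exact (mem_ball.mp hzy).le
  have hj := joined_of_near hf hg.continuous.continuousOn hgf hzy' (by rwa [add_halves])
  refine ⟨g, z, ⟨⟨hf.1, isProperMap_of_dist_le hf.2.1 (ε := δ / 2) ?_ ?_, fun x hx => ?_⟩,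
    ⟨univ, isOpen_univ, subset_univ _, g, hg.contDiffOn, fun _ _ => rfl⟩, fun x hx hxz => ?_⟩, hj⟩
  · exact hg.continuous.comp continuous_subtype_val
  · rintro ⟨x, hx⟩
    simpa [dist_eq_norm] using hgf x hx
  · obtain ⟨H, α, hH, h0, rfl, -⟩ := hj
    have h1 : H (x, 0) = g x := h0 (frontier_subset_closure hx)
    rw [← h1]
    exact hH.2.2.2 x hx 0 (by simp)
  · rw [surjective_iff_det_ne_zero]
    exact fun h => hz ⟨x, h, hxz⟩

end BrouwerDegree

theorem mainTheorem5 (k : ℕ) :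
    (∀ deg : (BrouwerDegree.E k → BrouwerDegree.E k) →
        Set (BrouwerDegree.E k) → BrouwerDegree.E k → ℤ,
      BrouwerDegree.SatisfiesAxioms deg →
      ∀ (f : BrouwerDegree.E k → BrouwerDegree.E k) (U : Set (BrouwerDegree.E k))
        (y : BrouwerDegree.E k), BrouwerDegree.Admissible f U y →
        (∀ (g : BrouwerDegree.E k → BrouwerDegree.E k) (z : BrouwerDegree.E k),
          BrouwerDegree.Regular g U z →
          BrouwerDegree.JoinedByAdmissibleHomotopy U g z f y →
          (BrouwerDegree.solutions g U z).Finite ∧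
            deg f U y = ∑ᶠ x ∈ BrouwerDegree.solutions g U z, BrouwerDegree.index g x) ∧
        (∀ (g : BrouwerDegree.E k → BrouwerDegree.E k) (z : BrouwerDegree.E k) (ε σ : ℝ),
          BrouwerDegree.Regular g U z → 0 ≤ ε → 0 ≤ σ →
          (∀ x ∈ closure U, ‖g x - f x‖ ≤ ε) → ‖z - y‖ ≤ σ →
          ENNReal.ofReal (ε + σ) < Metric.infEDist y (f '' frontier U) →
          (BrouwerDegree.solutions g U z).Finite ∧
            deg f U y = ∑ᶠ x ∈ BrouwerDegree.solutions g U z, BrouwerDegree.index g x)) ∧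
    (∀ deg₁ deg₂ : (BrouwerDegree.E k → BrouwerDegree.E k) →
        Set (BrouwerDegree.E k) → BrouwerDegree.E k → ℤ,
      BrouwerDegree.SatisfiesAxioms deg₁ → BrouwerDegree.SatisfiesAxioms deg₂ →
      ∀ (f : BrouwerDegree.E k → BrouwerDegree.E k) (U : Set (BrouwerDegree.E k))
        (y : BrouwerDegree.E k), BrouwerDegree.Admissible f U y →
        deg₁ f U y = deg₂ f U y) := by
  refine ⟨fun deg hd f U y hf => ⟨fun g z hg hj => ?_, fun g z ε σ hg _ _ hfg hyz hlt => ?_⟩,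
    fun deg₁ deg₂ h₁ h₂ f U y hf => ?_⟩
  · rw [hd.deg_eq_of_joined hf hg.1 hj]
    exact hd.deg_regular hg
  · rw [hd.deg_eq_of_joined hf hg.1 (BrouwerDegree.joined_of_near hf
      (continuousOn_iff_continuous_domRestrict.mpr hg.1.2.1.continuous) hfg hyz hlt)]
    exact hd.deg_regular hg
  -- One regular triple serves both degrees, and its index sum mentions neither.
  · obtain ⟨g, z, hg, hj⟩ := BrouwerDegree.exists_regular_near hf
    rw [h₁.deg_eq_of_joined hf hg.1 hj, h₂.deg_eq_of_joined hf hg.1 hj,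
      (h₁.deg_regular hg).2, (h₂.deg_regular hg).2]
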